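/- Consider a UAV hovering at height $h>0$ above the origin of the ground plane $\mathbb R^2$ and a D2D receiver located on the ground at the point with polar coordinates $(r,\varphi)$, $r\ge 0$. Let $P_d>0$ be the D2D transmit power, $P_u\ge 0$ the UAV transmit power, $N\ge 0$ the noise power, $\alpha_d>2$ the path loss exponent of the D2D links, $\alpha_u$ the path loss exponent of the link to the UAV, $\eta\ge 0$ the additional NLoS attenuation factor, $\lambda_d\ge 0$ the D2D density, $d_0>0$ the distance between the receiver and its own transmitter, and $\beta\ge 0$ the SINR threshold. Put $|X_u|=\sqrt{h^2+r^2}$. The receiver gets from its own transmitter the power $P_d d_0^{-\alpha_d}g_0$. The interfering D2D transmitters form a homogeneous Poisson point process of density $\lambda_d$ on $\mathbb R^2$, and the total D2D interference is $I_d^c=\sum_{i\neq 0}P_d d_i^{-\alpha_d}g_i\in[0,\infty]$, where $d_i$ is the distance from the $i$-th interfering transmitter to the receiver. The gains $g_0$ and $g_i$ are i.i.d. exponential random variables with mean $1$ (Rayleigh fading). The interference $I_u$ from the UAV equals $P_u|X_u|^{-\alpha_u}$ if the connection to the UAV is line-of-sight (LoS) and $\eta P_u|X_u|^{-\alpha_u}$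 otherwise (NLoS). The connection is LoS with probability $$P_{\rm LoS}=\frac{1}{1+C\exp(-B[\theta-C])},\qquad \theta=\frac{180}{\pi}\arcsin\frac{h}{|X_u|},$$ where $B\in\mathbb R$ and $C\ge 0$ are environment constants, and $P_{\rm NLoS}=1-P_{\rm LoS}$. The transmitter locations, the gains and the LoS/NLoS state are independent. Then the coverage probability of the receiver, that is, the probability that $\gamma_d=\dfrac{P_d d_0^{-\alpha_d}g_0}{I_d^c+I_u+N}$ is at least $\beta$, is $$\mathbb P[\gamma_d\ge\beta]=\exp\left(-\frac{2\pi^2\lambda_d\beta^{2/\alpha_d}d_0^2}{\alpha_d\sin(2\pi/\alpha_d)}-\frac{\beta d_0^{\alpha_d}N}{P_d}\right)\left(P_{\rm LoS}\exp\left(-\frac{\beta d_0^{\alpha_d}P_u|X_u|^{-\alpha_u}}{P_d}\right)+P_{\rm NLoS}\exp\left(-\frac{\beta d_0^{\alpha_d}\eta P_u|X_u|^{-\alpha_u}}{P_d}\right)\right).$$ (If the denominator of $\gamma_d$ vanishes, $\gamma_d$ is read as $+\infty$ when $g_0>0$.) -/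

import Mathlib

open MeasureTheory ProbabilityTheory
open scoped ENNReal

noncomputable section

namespace UAVD2D

/-- The ground plane with the Euclidean distance and Lebesgue measure. -/
abbrev Plane : Type := EuclideanSpace ℝ (Fin 2)

/-- The point of the plane with polar coordinates `(r, φ)`. -/
def polarPoint (r φ : ℝ) : Plane := !₂[r * Real.cos φ, r * Real.sin φ]

/-- `Φ` is a Poisson point process with intensity measure `Λ` on the probability space `(Ω, μ)`,
as a random measure: the number of points in a set `A` with `Λ A < ∞` is Poisson with mean `Λ A`,
and the numbers of points in pairwise disjoint sets are independent. -/
structure IsPoissonProcess {Ω E : Type*} [MeasurableSpace Ω] [MeasurableSpace E]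
    (Φ : Ω → Measure E) (Λ : Measure E) (μ : Measure Ω) : Prop where
  measurable : Measurable Φ
  hasLaw_count : ∀ A : Set E, MeasurableSet A → Λ A ≠ ∞ →
    HasLaw (fun ω => Φ ω A)
      ((poissonMeasure (Λ A).toNNReal).map (fun n : ℕ => (n : ℝ≥0∞))) μ
  indep_count : ∀ (m : ℕ) (A : Fin m → Set E), (∀ j, MeasurableSet (A j)) →
    Pairwise (fun j k => Disjoint (A j) (A k)) → iIndepFun (fun j ω => Φ ω (A j)) μ

/-- The counting measure (with multiplicity) of a family of points. -/
def pointMeasure {ι E : Type*} [MeasurableSpace E] (x : ι → E) : Measure E :=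
  Measure.sum fun i => Measure.dirac (x i)

/-- Distance between the UAV at height `h` and a ground receiver at horizontal distance `r`. -/
def uavDist (h r : ℝ) : ℝ := Real.sqrt (h ^ 2 + r ^ 2)

/-- Elevation angle, in degrees. -/
def elevation (h r : ℝ) : ℝ := 180 / Real.pi * Real.arcsin (h / uavDist h r)

/-- Probability of a line-of-sight connection to the UAV, with environment constants `B`, `C`. -/
def losProb (B C h r : ℝ) : ℝ := 1 / (1 + C * Real.exp (-B * (elevation h r - C)))

/-- Probability of a non-line-of-sight connection to the UAV. -/
def nlosProb (B C h r : ℝ) : ℝ := 1 - losProb B C h r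

/-- Power received from the UAV; `true` stands for a line-of-sight connection. -/
def uavPower (Pu αu η h r : ℝ) : Bool → ℝ
  | true => Pu * uavDist h r ^ (-αu)
  | false => η * Pu * uavDist h r ^ (-αu)

/-- Power received over a D2D link of length `d` with channel gain `g`. -/
def d2dPower (Pd αd d g : ℝ) : ℝ := Pd * d ^ (-αd) * g

/-- Total power, in `[0, ∞]`, received at `y` from the interfering D2D transmitters located at the
points `x i`, with channel gains `g i`. -/
def d2dInterference {ι : Type*} (Pd αd : ℝ) (y : Plane) (x : ι → Plane) (g : ι → ℝ) : ℝ≥0∞ :=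
  ∑' i, ENNReal.ofReal (d2dPower Pd αd (dist (x i) y) (g i))

/-- Signal to interference plus noise ratio for received signal power `S`, D2D interference `Id`,
UAV interference `Iu` and noise power `N`. -/
def sinr (S : ℝ) (Id : ℝ≥0∞) (Iu N : ℝ) : ℝ≥0∞ :=
  ENNReal.ofReal S / (Id + ENNReal.ofReal Iu + ENNReal.ofReal N)

/-- The random part of the network. `X i` is the location of the `i`-th interfering D2D
transmitter, `g none` the gain of the desired link, `g (some i)` the gain of the `i`-th interfering
link, and `L` tells whether the connection to the UAV is line-of-sight.
The interferers form a homogeneous Poisson point process of density `lam` on the whole plane, the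
gains are i.i.d. exponential with mean one (Rayleigh fading), the connection to the UAV is
line-of-sight with probability `p`, and locations, gains and connection type are independent. -/
structure IsNetwork {Ω ι : Type*} [MeasurableSpace Ω] (μ : Measure Ω)
    (X : ι → Ω → Plane) (g : Option ι → Ω → ℝ) (L : Ω → Bool) (lam p : ℝ) : Prop where
  measurable_location : ∀ i, Measurable (X i)
  poisson : IsPoissonProcess (fun ω => pointMeasure fun i => X i ω)
    (ENNReal.ofReal lam • (volume : Measure Plane)) μ
  measurable_gain : ∀ k, Measurable (g k)
  rayleigh : ∀ k, HasLaw (g k) (expMeasure 1) μ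
  indep_gain : iIndepFun g μ
  measurable_los : Measurable L
  prob_los : μ.real {ω | L ω = true} = p
  indep_location_gain : IndepFun (fun ω i => X i ω) (fun ω k => g k ω) μ
  indep_los : IndepFun (fun ω => ((fun i => X i ω), (fun k => g k ω))) L μ

/-- SINR of the D2D receiver at polar position `(r, φ)` whose own transmitter is at distance `d₀`,
in the outcome `ω`. -/
def d2dSinr {Ω ι : Type*} (Pd Pu αd αu η d₀ N h r φ : ℝ)
    (X : ι → Ω → Plane) (g : Option ι → Ω → ℝ) (L : Ω → Bool) (ω : Ω) : ℝ≥0∞ :=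
  sinr (d2dPower Pd αd d₀ (g none ω))
    (d2dInterference Pd αd (polarPoint r φ) (fun i => X i ω) (fun i => g (some i) ω))
    (uavPower Pu αu η h r (L ω)) N

end UAVD2D

end

/-!
The fading gain of the desired link is exponential, so an outcome in which the normalized total
interference plus noise is `T` is covered with conditional probability `e^{-T}`, and the coverage
probability is a Laplace transform of `T`. The noise and the power of the UAV contribute explicit
factors. This leaves the Laplace transform of the interference of the other transmitters.

Given the positions, the independent exponential gains turn that transform into the product of the
factors `1 / (1 + a (X i))`, where `a x = s * dist x y ^ (-αd)` and `s = β * d₀ ^ αd`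
(`measure_add_tsum_gain_le`). With `f = log (1 + a)`, this product is `exp (-∫ f dΦ)` for the
Poisson process `Φ` of positions, and the Laplace functional of a Poisson process
(`IsPoissonProcess.lintegral_expNeg_lintegral`) gives its mean
`exp (-lam * ∫ (1 - 1 / (1 + a x)) dx)`. The Laplace functional is computed for simple functions,
where the counts of the level sets are independent Poisson variables, and extended by monotone
convergence. The integral over the plane is `∫ s / (s + ‖x‖ ^ αd) dx`, which a Laplace
representation of the integrand reduces to `Γ (2 / αd) * Γ (1 - 2 / αd)`; Euler's reflection formula
produces the sine (`lintegral_div_add_norm_rpow`).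

All transforms are taken in `[0, ∞]` through `expNeg x = e^{-x}` with `expNeg ∞ = 0`. Hence no
finiteness or integrability of the interference has to be known in advance: an infinite
interference simply contributes zero.
-/

namespace UAVD2D

open Filter Topology

/-! ### The exponential `e⁻ˣ` on `[0, ∞]` -/

/-- The function `x ↦ e⁻ˣ` from `[0, ∞]` to itself, with `e^{-∞} = 0`. -/
noncomputable def expNeg (x : ℝ≥0∞) : ℝ≥0∞ := EReal.exp (-(x : EReal))

lemma continuous_expNeg : Continuous expNeg :=
  ENNReal.continuous_exp.comp (continuous_neg.comp continuous_coe_ennreal_ereal)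

lemma measurable_expNeg : Measurable expNeg := continuous_expNeg.measurable

lemma antitone_expNeg : Antitone expNeg := fun x y hxy =>
  EReal.exp_monotone (EReal.neg_le_neg_iff.2 (by exact_mod_cast hxy))

@[simp] lemma expNeg_zero : expNeg 0 = 1 := by simp [expNeg]

@[simp] lemma expNeg_top : expNeg ∞ = 0 := by simp [expNeg]

lemma expNeg_le_one (x : ℝ≥0∞) : expNeg x ≤ 1 := by
  simpa using antitone_expNeg (zero_le : (0 : ℝ≥0∞) ≤ x)

lemma expNeg_ne_top (x : ℝ≥0∞) : expNeg x ≠ ∞ :=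
  ((expNeg_le_one x).trans_lt ENNReal.one_lt_top).ne

lemma expNeg_ofReal {x : ℝ} (hx : 0 ≤ x) :
    expNeg (ENNReal.ofReal x) = ENNReal.ofReal (Real.exp (-x)) := by
  rw [expNeg, EReal.coe_ennreal_ofReal, max_eq_left hx, ← EReal.coe_neg, EReal.exp_coe]

lemma expNeg_add (x y : ℝ≥0∞) : expNeg (x + y) = expNeg x * expNeg y := by
  rw [expNeg, EReal.coe_ennreal_add, EReal.neg_add (.inl (EReal.coe_ennreal_ne_bot _))
    (.inr (EReal.coe_ennreal_ne_bot _)), sub_eq_add_neg, EReal.exp_add]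
  rfl

lemma expNeg_sum {κ : Type*} (s : Finset κ) (f : κ → ℝ≥0∞) :
    expNeg (∑ i ∈ s, f i) = ∏ i ∈ s, expNeg (f i) := by
  classical
  induction s using Finset.induction_on with
  | empty => simp
  | insert a s ha ih => rw [Finset.sum_insert ha, Finset.prod_insert ha, expNeg_add, ih]

lemma expNeg_mul_nat (x : ℝ≥0∞) (n : ℕ) : expNeg (x * n) = expNeg x ^ n := by
  have h := expNeg_sum (Finset.range n) (fun _ => x)
  rwa [Finset.sum_const, Finset.prod_const, Finset.card_range, nsmul_eq_mul, mul_comm] at h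

/-! ### The Laplace functional of a Poisson process -/

/-- The Laplace transform of the Poisson distribution, evaluated at any `a ∈ [0, ∞]`. -/
lemma lintegral_expNeg_poissonMeasure (r : NNReal) (a : ℝ≥0∞) :
    ∫⁻ n : ℕ, expNeg (a * n) ∂(poissonMeasure r) = expNeg (r * (1 - expNeg a)) := by
  obtain ⟨q, hq⟩ : ∃ q : NNReal, (q : ℝ≥0∞) = expNeg a :=
    ⟨_, ENNReal.coe_toNNReal (expNeg_ne_top a)⟩
  have hq1 : (q : ℝ) ≤ 1 := by
    have := expNeg_le_one a
    rw [← hq] at this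
    exact_mod_cast this
  have hR : (r : ℝ≥0∞) * (1 - expNeg a) = ENNReal.ofReal (r * (1 - q)) := by
    rw [← hq, ENNReal.ofReal_mul r.coe_nonneg, ENNReal.ofReal_sub _ q.coe_nonneg]
    simp
  have hsum : HasSum (fun n : ℕ => Real.exp (-r) * ((r * q : ℝ) ^ n / n.factorial))
      (Real.exp (-(r * (1 - q)))) := by
    have h := (NormedSpace.expSeries_div_hasSum_exp (r * q : ℝ)).mul_left (Real.exp (-r))
    rwa [← Real.exp_eq_exp_ℝ, ← Real.exp_add,
      show -(r : ℝ) + r * q = -(r * (1 - q)) by ring] at h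
  rw [lintegral_countable', hR, expNeg_ofReal (mul_nonneg r.coe_nonneg (sub_nonneg.2 hq1)),
    ← hsum.tsum_eq, ENNReal.ofReal_tsum_of_nonneg (fun n => by positivity) hsum.summable]
  refine tsum_congr fun n => ?_
  rw [expNeg_mul_nat, ← hq, poissonMeasure_singleton,
    show ((q : ℝ≥0∞) ^ n) = ENNReal.ofReal ((q : ℝ) ^ n) by
      rw [ENNReal.ofReal_pow q.coe_nonneg, ENNReal.ofReal_coe_nnreal],
    ← ENNReal.ofReal_mul (by positivity)]
  congr 1
  rw [mul_pow]
  ring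

section PoissonProcess

variable {Ω E : Type*} [MeasurableSpace Ω] [MeasurableSpace E]

lemma IsPoissonProcess.lintegral_expNeg_mul_count {Φ : Ω → Measure E} {Λ : Measure E}
    {μ : Measure Ω} (h : IsPoissonProcess Φ Λ μ) (a : ℝ≥0∞) {A : Set E} (hA : MeasurableSet A)
    (hΛ : Λ A ≠ ∞) :
    ∫⁻ ω, expNeg (a * Φ ω A) ∂μ = expNeg ((1 - expNeg a) * Λ A) := by
  have hm : Measurable fun x : ℝ≥0∞ => expNeg (a * x) :=
    measurable_expNeg.comp (measurable_const_mul a)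
  rw [(h.hasLaw_count A hA hΛ).lintegral_comp (f := fun x => expNeg (a * x)) hm.aemeasurable,
    lintegral_map hm (measurable_from_top), lintegral_expNeg_poissonMeasure,
    ENNReal.coe_toNNReal hΛ, mul_comm]

/-- The Laplace functional at a simple function cut off to a set of finite intensity: the counts of
the level sets are independent Poisson variables. -/
lemma IsPoissonProcess.lintegral_expNeg_simpleFunc {Φ : Ω → Measure E} {Λ : Measure E}
    {μ : Measure Ω} (h : IsPoissonProcess Φ Λ μ) (f : SimpleFunc E ℝ≥0∞) {s : Set E}
    (hs : MeasurableSet s) (hΛ : Λ s ≠ ∞) :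
    ∫⁻ ω, expNeg (∫⁻ x in s, f x ∂(Φ ω)) ∂μ = expNeg (∫⁻ x in s, (1 - expNeg (f x)) ∂Λ) := by
  let e := f.range.equivFin
  let y : Fin f.range.card → ℝ≥0∞ := fun j => (e.symm j : ℝ≥0∞)
  let A : Fin f.range.card → Set E := fun j => f ⁻¹' {y j} ∩ s
  have hA : ∀ j, MeasurableSet (A j) := fun j => (f.measurableSet_fiber _).inter hs
  have hyinj : Function.Injective y := fun i j hij => e.symm.injective (Subtype.ext hij)
  have hdisj : Pairwise fun j k => Disjoint (A j) (A k) := by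
    intro j k hjk
    refine Set.disjoint_left.2 fun x hx hx' => hjk (hyinj ?_)
    exact hx.1.symm.trans hx'.1
  -- Both the exponent on the left (`ν = Φ ω`, `g = id`) and the one on the right are of this form.
  have hsum : ∀ (ν : Measure E) (g : ℝ≥0∞ → ℝ≥0∞),
      ∫⁻ x in s, g (f x) ∂ν = ∑ j, g (y j) * ν (A j) := by
    intro ν g
    have h1 : ∫⁻ x in s, g (f x) ∂ν = (f.map g).lintegral (ν.restrict s) := by
      rw [← SimpleFunc.lintegral_eq_lintegral]
      rfl
    rw [h1, SimpleFunc.map_lintegral, ← Finset.sum_coe_sort, ← e.symm.sum_comp]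
    refine Finset.sum_congr rfl fun j _ => ?_
    rw [Measure.restrict_apply (f.measurableSet_fiber _)]
  have hΛA : ∀ j, Λ (A j) ≠ ∞ := fun j => measure_ne_top_of_subset Set.inter_subset_right hΛ
  have hind : iIndepFun (fun j ω => expNeg (y j * Φ ω (A j))) μ :=
    (h.indep_count _ A hA hdisj).comp (fun j x => expNeg (y j * x))
      fun j => measurable_expNeg.comp (measurable_const_mul _)
  have hmeas : ∀ j, Measurable fun ω => expNeg (y j * Φ ω (A j)) := fun j =>
    measurable_expNeg.comp
      (((Measure.measurable_coe (hA j)).comp h.measurable).const_mul _)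
  calc ∫⁻ ω, expNeg (∫⁻ x in s, f x ∂(Φ ω)) ∂μ
      = ∫⁻ ω, ∏ j, expNeg (y j * Φ ω (A j)) ∂μ := by
        refine lintegral_congr fun ω => ?_
        exact (congrArg expNeg (hsum (Φ ω) id)).trans (expNeg_sum _ _)
    _ = ∏ j, ∫⁻ ω, expNeg (y j * Φ ω (A j)) ∂μ :=
        lintegral_prod_eq_prod_lintegral_of_indepFun _ _ hind hmeas
    _ = ∏ j, expNeg ((1 - expNeg (y j)) * Λ (A j)) :=
        Finset.prod_congr rfl fun j _ => h.lintegral_expNeg_mul_count _ (hA j) (hΛA j)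
    _ = expNeg (∫⁻ x in s, (1 - expNeg (f x)) ∂Λ) := by
        rw [hsum Λ fun t => 1 - expNeg t, expNeg_sum]

/-- Monotone convergence for integrals over an increasing sequence of sets exhausting the space. -/
lemma tendsto_setLIntegral_of_monotone (ν : Measure E) {S : ℕ → Set E} (hS : Monotone S)
    (hSm : ∀ n, MeasurableSet (S n)) (hSu : ⋃ n, S n = Set.univ) {F : ℕ → E → ℝ≥0∞}
    {f : E → ℝ≥0∞} (hF : ∀ n, Measurable (F n)) (hmono : Monotone F)
    (hlim : ∀ x, Tendsto (fun n => F n x) atTop (𝓝 (f x))) :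
    Tendsto (fun n => ∫⁻ x in S n, F n x ∂ν) atTop (𝓝 (∫⁻ x, f x ∂ν)) := by
  simp_rw [← lintegral_indicator (hSm _)]
  refine lintegral_tendsto_of_tendsto_of_monotone
    (fun n => ((hF n).indicator (hSm n)).aemeasurable) (ae_of_all _ fun x m n hmn => ?_)
    (ae_of_all _ fun x => ?_)
  · exact (Set.indicator_le_indicator_of_subset (hS hmn) (fun _ => zero_le) x).trans
      (Set.indicator_le_indicator (hmono hmn x))
  · obtain ⟨k, hk⟩ := Set.mem_iUnion.1 (hSu ▸ Set.mem_univ x)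
    refine (hlim x).congr' ?_
    filter_upwards [eventually_ge_atTop k] with n hn
    rw [Set.indicator_of_mem (hS hn hk)]

/-- The Laplace functional of a Poisson process with σ-finite intensity. -/
theorem IsPoissonProcess.lintegral_expNeg_lintegral {Φ : Ω → Measure E} {Λ : Measure E}
    [SigmaFinite Λ] {μ : Measure Ω} [IsFiniteMeasure μ] (h : IsPoissonProcess Φ Λ μ)
    {f : E → ℝ≥0∞} (hf : Measurable f) :
    ∫⁻ ω, expNeg (∫⁻ x, f x ∂(Φ ω)) ∂μ = expNeg (∫⁻ x, (1 - expNeg (f x)) ∂Λ) := by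
  let S := spanningSets Λ
  let F := SimpleFunc.eapprox f
  have hSm : ∀ n, MeasurableSet (S n) := measurableSet_spanningSets Λ
  have hF : ∀ n, Measurable (F n) := fun n => (F n).measurable
  have hFlim : ∀ x, Tendsto (fun n => F n x) atTop (𝓝 (f x)) := fun x => by
    rw [← SimpleFunc.iSup_eapprox_apply hf x]
    exact tendsto_atTop_iSup fun m n hmn => SimpleFunc.monotone_eapprox f hmn x
  have hΦ : ∀ ω, Tendsto (fun n => ∫⁻ x in S n, F n x ∂(Φ ω)) atTop (𝓝 (∫⁻ x, f x ∂(Φ ω))) :=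
    fun ω => tendsto_setLIntegral_of_monotone (Φ ω) (monotone_spanningSets Λ) hSm
      (iUnion_spanningSets Λ) hF (fun m n hmn => SimpleFunc.monotone_eapprox f hmn) hFlim
  have hΛ : Tendsto (fun n => ∫⁻ x in S n, (1 - expNeg (F n x)) ∂Λ) atTop
      (𝓝 (∫⁻ x, (1 - expNeg (f x)) ∂Λ)) := by
    refine tendsto_setLIntegral_of_monotone Λ (monotone_spanningSets Λ) hSm
      (iUnion_spanningSets Λ) (fun n => (measurable_expNeg.comp (hF n)).const_sub _)
      (fun m n hmn x => tsub_le_tsub_left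
        (antitone_expNeg (SimpleFunc.monotone_eapprox f hmn x)) _) fun x => ?_
    exact ENNReal.Tendsto.sub tendsto_const_nhds
      ((continuous_expNeg.tendsto _).comp (hFlim x)) (.inl ENNReal.one_ne_top)
  have hL : Tendsto (fun n => ∫⁻ ω, expNeg (∫⁻ x in S n, F n x ∂(Φ ω)) ∂μ) atTop
      (𝓝 (∫⁻ ω, expNeg (∫⁻ x, f x ∂(Φ ω)) ∂μ)) := by
    refine tendsto_lintegral_of_dominated_convergence' (fun _ => 1) (fun n => ?_)
      (fun n => ae_of_all _ fun ω => expNeg_le_one _) (by simp)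
      (ae_of_all _ fun ω => (continuous_expNeg.tendsto _).comp (hΦ ω))
    refine Measurable.aemeasurable (measurable_expNeg.comp ?_)
    simp_rw [← lintegral_indicator (hSm n)]
    exact (Measure.measurable_lintegral ((hF n).indicator (hSm n))).comp h.measurable
  refine tendsto_nhds_unique hL ?_
  have h2 : ∀ n, ∫⁻ ω, expNeg (∫⁻ x in S n, F n x ∂(Φ ω)) ∂μ =
      expNeg (∫⁻ x in S n, (1 - expNeg (F n x)) ∂Λ) := fun n =>
    h.lintegral_expNeg_simpleFunc (F n) (hSm n) (measure_spanningSets_lt_top Λ n).ne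
  simp_rw [h2]
  exact (continuous_expNeg.tendsto _).comp hΛ

end PoissonProcess

/-! ### Exponential gains -/

lemma lintegral_expMeasure_one {f : ℝ → ℝ≥0∞} (hf : Measurable f) :
    ∫⁻ x, f x ∂(expMeasure 1) = ∫⁻ x in Set.Ioi 0, ENNReal.ofReal (Real.exp (-x)) * f x := by
  have hpdf : Measurable (exponentialPDF 1) := (measurable_exponentialPDFReal 1).ennreal_ofReal
  have h : expMeasure 1 = volume.withDensity (exponentialPDF 1) := rfl
  rw [h, lintegral_withDensity_eq_lintegral_mul _ hpdf hf, ← lintegral_indicator measurableSet_Ioi]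
  refine lintegral_congr_ae ?_
  filter_upwards [volume.ae_ne 0] with x hx
  rcases lt_or_gt_of_ne hx with hx | hx
  · simp [exponentialPDF_of_neg hx, hx.le]
  · simp [exponentialPDF_of_nonneg hx.le, hx]

lemma lintegral_Ioi_exp_neg_mul {b : ℝ} (hb : 0 < b) (c : ℝ) :
    ∫⁻ x in Set.Ioi c, ENNReal.ofReal (Real.exp (-b * x)) =
      ENNReal.ofReal (Real.exp (-b * c) / b) := by
  rw [← ofReal_integral_eq_lintegral_ofReal (integrableOn_exp_mul_Ioi (neg_lt_zero.2 hb) c)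
    (ae_of_all _ fun x => (Real.exp_pos _).le), integral_exp_mul_Ioi (neg_lt_zero.2 hb) c,
    neg_div_neg_eq]

/-- The tail of the exponential distribution at a threshold `v ∈ [0, ∞]`. -/
lemma expMeasure_one_le_ofReal (v : ℝ≥0∞) :
    expMeasure 1 {x | v ≤ ENNReal.ofReal x} = expNeg v := by
  have hm : MeasurableSet {x : ℝ | v ≤ ENNReal.ofReal x} :=
    measurableSet_le measurable_const ENNReal.measurable_ofReal
  rw [← lintegral_indicator_one hm, lintegral_expMeasure_one (measurable_one.indicator hm)]
  rcases eq_or_ne v ∞ with rfl | hv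
  · simp
  obtain ⟨t, ht, rfl⟩ : ∃ t : ℝ, 0 ≤ t ∧ ENNReal.ofReal t = v :=
    ⟨v.toReal, ENNReal.toReal_nonneg, ENNReal.ofReal_toReal hv⟩
  have h := lintegral_Ioi_exp_neg_mul one_pos t
  rw [neg_one_mul, div_one] at h
  rw [expNeg_ofReal ht, ← h, ← lintegral_indicator measurableSet_Ioi,
    ← lintegral_indicator measurableSet_Ioi]
  refine lintegral_congr_ae ?_
  filter_upwards [volume.ae_ne t] with x hx
  rcases lt_or_gt_of_ne hx with hx | hx
  · by_cases h0 : 0 < x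
    · have : ¬ ENNReal.ofReal t ≤ ENNReal.ofReal x := by
        rw [ENNReal.ofReal_le_ofReal_iff h0.le]; exact hx.not_ge
      simp [this, hx.le]
    · simp [h0, hx.le]
  · have h0 : 0 < x := ht.trans_lt hx
    simp [h0, hx, ENNReal.ofReal_le_ofReal hx.le]

/-- The Laplace transform of the exponential distribution. -/
lemma lintegral_expNeg_expMeasure_one {a : ℝ} (ha : 0 ≤ a) :
    ∫⁻ x, expNeg (ENNReal.ofReal (a * x)) ∂(expMeasure 1) =
      expNeg (ENNReal.ofReal (Real.log (1 + a))) := by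
  have ha1 : 0 < 1 + a := by linarith
  have hm : Measurable fun x : ℝ => expNeg (ENNReal.ofReal (a * x)) :=
    measurable_expNeg.comp (ENNReal.measurable_ofReal.comp (measurable_const_mul a))
  rw [lintegral_expMeasure_one hm,
    expNeg_ofReal (Real.log_nonneg (by linarith)), Real.exp_neg, Real.exp_log ha1]
  have h := lintegral_Ioi_exp_neg_mul ha1 0
  rw [mul_zero, Real.exp_zero, one_div] at h
  rw [← h]
  refine setLIntegral_congr_fun measurableSet_Ioi fun x hx => ?_
  have hx : 0 < x := hx
  rw [expNeg_ofReal (mul_nonneg ha hx.le), ← ENNReal.ofReal_mul (Real.exp_pos _).le,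
    ← Real.exp_add]
  congr 2
  ring

section Gains

variable {Ω ι : Type*} [MeasurableSpace Ω] {μ : Measure Ω}

/-- For i.i.d. exponential variables, the Laplace transform of a countable nonnegative linear
combination is the product of the factors `1 / (1 + a i)`, here in logarithmic form. -/
lemma lintegral_expNeg_tsum_gain [Countable ι] [IsProbabilityMeasure μ] {g : ι → Ω → ℝ}
    (hg : ∀ i, Measurable (g i)) (hlaw : ∀ i, HasLaw (g i) (expMeasure 1) μ)
    (hind : iIndepFun g μ) {a : ι → ℝ} (ha : ∀ i, 0 ≤ a i) :
    ∫⁻ ω, expNeg (∑' i, ENNReal.ofReal (a i * g i ω)) ∂μ =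
      expNeg (∑' i, ENNReal.ofReal (Real.log (1 + a i))) := by
  have hφ : ∀ i, Measurable fun x : ℝ => expNeg (ENNReal.ofReal (a i * x)) := fun i =>
    measurable_expNeg.comp (ENNReal.measurable_ofReal.comp (measurable_const_mul (a i)))
  have hfin : ∀ s : Finset ι, ∫⁻ ω, expNeg (∑ i ∈ s, ENNReal.ofReal (a i * g i ω)) ∂μ =
      expNeg (∑ i ∈ s, ENNReal.ofReal (Real.log (1 + a i))) := by
    intro s
    simp_rw [expNeg_sum]
    rw [lintegral_prod_eq_prod_lintegral_of_indepFun s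
      (fun i ω => expNeg (ENNReal.ofReal (a i * g i ω))) (hind.comp _ hφ)
      fun i => (hφ i).comp (hg i)]
    refine Finset.prod_congr rfl fun i _ => ?_
    rw [(hlaw i).lintegral_comp (hφ i).aemeasurable, lintegral_expNeg_expMeasure_one (ha i)]
  have hL : Tendsto (fun s : Finset ι => ∫⁻ ω, expNeg (∑ i ∈ s, ENNReal.ofReal (a i * g i ω)) ∂μ)
      atTop (𝓝 (∫⁻ ω, expNeg (∑' i, ENNReal.ofReal (a i * g i ω)) ∂μ)) := by
    refine tendsto_lintegral_filter_of_dominated_convergence (fun _ => 1)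
      (Eventually.of_forall fun s => measurable_expNeg.comp
        (Finset.measurable_fun_sum s fun i _ => ((hg i).const_mul (a i)).ennreal_ofReal))
      (Eventually.of_forall fun s => ae_of_all _ fun ω => expNeg_le_one _) (by simp)
      (ae_of_all _ fun ω => (continuous_expNeg.tendsto _).comp ENNReal.summable.hasSum)
  refine tendsto_nhds_unique hL ?_
  simp_rw [hfin]
  exact (continuous_expNeg.tendsto _).comp ENNReal.summable.hasSum

/-- An exponential variable exceeds an independent `[0, ∞]`-valued variable `T` with probability
`E e^{-T}`. -/
lemma measure_le_ofReal_of_indepFun [IsProbabilityMeasure μ] {T : Ω → ℝ≥0∞} {S : Ω → ℝ}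
    (hT : Measurable T) (hS : Measurable S) (hlaw : HasLaw S (expMeasure 1) μ)
    (hind : IndepFun T S μ) :
    μ {ω | T ω ≤ ENNReal.ofReal (S ω)} = ∫⁻ ω, expNeg (T ω) ∂μ := by
  have hm : MeasurableSet {p : ℝ≥0∞ × ℝ | p.1 ≤ ENNReal.ofReal p.2} :=
    measurableSet_le measurable_fst (ENNReal.measurable_ofReal.comp measurable_snd)
  have : IsProbabilityMeasure (μ.map S) := Measure.isProbabilityMeasure_map hS.aemeasurable
  have h := (indepFun_iff_map_prod_eq_prod_map_map hT.aemeasurable hS.aemeasurable).1 hind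
  have h1 : μ {ω | T ω ≤ ENNReal.ofReal (S ω)} =
      μ.map (fun ω => (T ω, S ω)) {p : ℝ≥0∞ × ℝ | p.1 ≤ ENNReal.ofReal p.2} := by
    rw [Measure.map_apply (hT.prodMk hS) hm]
    rfl
  rw [h1, h, Measure.prod_apply hm, lintegral_map (measurable_measure_prodMk_left hm) hT,
    hlaw.map_eq]
  exact lintegral_congr fun ω => expMeasure_one_le_ofReal (T ω)

lemma measurable_tsum_ofReal_mul [Countable ι] {Ω' : Type*} {m : MeasurableSpace Ω'}
    {g : ι → Ω' → ℝ} (hg : ∀ i, Measurable (g i)) (a : ι → ℝ) :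
    Measurable fun ω => ∑' i, ENNReal.ofReal (a i * g i ω) :=
  Measurable.tsum fun i => ((hg i).const_mul (a i)).ennreal_ofReal

/-- The total interference is independent of the gain of the desired link, because it is measurable
with respect to the σ-algebra generated by the other gains. -/
lemma indepFun_tsum_gain [Countable ι] {g : Option ι → Ω → ℝ}
    (hg : ∀ k, Measurable (g k)) (hind : iIndepFun g μ) (v : ℝ≥0∞) (a : ι → ℝ) :
    IndepFun (fun ω => v + ∑' i, ENNReal.ofReal (a i * g (some i) ω)) (g none) μ := by
  have hdisj : Disjoint (Set.range (some : ι → Option ι)) {none} := by simp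
  have h := indep_iSup_of_disjoint (fun k => (hg k).comap_le) hind.iIndep hdisj
  have hle : ∀ k ∈ Set.range (some : ι → Option ι), MeasurableSpace.comap (g k) inferInstance ≤
      ⨆ k ∈ Set.range (some : ι → Option ι), MeasurableSpace.comap (g k) inferInstance :=
    fun k hk => le_iSup₂_of_le k hk le_rfl
  rw [IndepFun_iff_Indep]
  refine indep_of_indep_of_le_left (indep_of_indep_of_le_right h ?_) ?_
  · exact le_iSup₂_of_le none rfl le_rfl
  · rw [← measurable_iff_comap_le]
    exact (measurable_tsum_ofReal_mul
      (fun i => measurable_iff_comap_le.2 (hle (some i) ⟨i, rfl⟩)) a).const_add v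

/-- The conditional coverage probability given the positions of all transmitters: `v` collects the
normalized deterministic interference, and `a i` is the normalized mean power of interferer `i`. -/
lemma measure_add_tsum_gain_le [Countable ι] [IsProbabilityMeasure μ] {g : Option ι → Ω → ℝ}
    (hg : ∀ k, Measurable (g k)) (hlaw : ∀ k, HasLaw (g k) (expMeasure 1) μ)
    (hind : iIndepFun g μ) (v : ℝ≥0∞) {a : ι → ℝ} (ha : ∀ i, 0 ≤ a i) :
    μ {ω | v + ∑' i, ENNReal.ofReal (a i * g (some i) ω) ≤ ENNReal.ofReal (g none ω)} =
      expNeg v * expNeg (∑' i, ENNReal.ofReal (Real.log (1 + a i))) := by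
  have hT : Measurable fun ω => ∑' i, ENNReal.ofReal (a i * g (some i) ω) :=
    measurable_tsum_ofReal_mul (fun i => hg (some i)) a
  rw [measure_le_ofReal_of_indepFun (hT.const_add v) (hg none) (hlaw none)
    (indepFun_tsum_gain hg hind v a)]
  simp_rw [expNeg_add]
  have hT' : Measurable fun ω => expNeg (∑' i, ENNReal.ofReal (a i * g (some i) ω)) :=
    measurable_expNeg.comp hT
  rw [lintegral_const_mul _ hT',
    lintegral_expNeg_tsum_gain (fun i => hg (some i)) (fun i => hlaw (some i))
      (hind.precomp (Option.some_injective ι)) ha]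

end Gains

/-! ### The interference integral over the plane -/

lemma lintegral_exp_neg_mul_norm_rpow {α t : ℝ} (hα : 0 < α) (ht : 0 < t) :
    ∫⁻ x : Plane, ENNReal.ofReal (Real.exp (-t * ‖x‖ ^ α)) =
      ENNReal.ofReal (2 * Real.pi * (t ^ (-(2 / α)) * (1 / α) * Real.Gamma (2 / α))) := by
  have hrank : Module.finrank ℝ Plane = 2 := by simp
  have hball : (volume : Measure Plane).real (Metric.ball 0 1) = Real.pi := by
    rw [Measure.real, EuclideanSpace.volume_ball_fin_two]
    simp [Real.pi_pos.le]
  have hint : Integrable (fun x : Plane => Real.exp (-t * ‖x‖ ^ α)) volume := by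
    rw [integrable_fun_norm_addHaar volume (f := fun ρ : ℝ => Real.exp (-t * ρ ^ α)), hrank]
    simpa using integrableOn_rpow_mul_exp_neg_mul_rpow (p := α) (s := 1) (b := t)
      (by norm_num) hα ht
  rw [← ofReal_integral_eq_lintegral_ofReal hint (ae_of_all _ fun x => (Real.exp_pos _).le),
    integral_fun_norm_addHaar volume (fun ρ : ℝ => Real.exp (-t * ρ ^ α)), hrank, hball]
  have h := integral_rpow_mul_exp_neg_mul_rpow (p := α) (q := 1) (b := t) hα (by norm_num) ht
  simp only [Real.rpow_one] at h
  simp only [Nat.add_one_sub_one, pow_one, smul_eq_mul, nsmul_eq_mul]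
  rw [h]
  congr 1
  norm_num [neg_div]
  ring

lemma lintegral_exp_neg_mul_rpow {s b : ℝ} (hs : 0 < s) (hb : b < 1) :
    ∫⁻ t in Set.Ioi 0, ENNReal.ofReal (s * (t ^ (-b) * Real.exp (-s * t))) =
      ENNReal.ofReal (s ^ b * Real.Gamma (1 - b)) := by
  have h := integral_rpow_mul_exp_neg_mul_rpow (p := 1) (q := -b) (b := s) one_pos
    (by linarith) hs
  have hint := integrableOn_rpow_mul_exp_neg_mul_rpow (p := 1) (s := -b) (b := s)
    (by linarith) one_pos hs
  simp only [Real.rpow_one] at h hint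
  rw [← ofReal_integral_eq_lintegral_ofReal (hint.const_mul s), integral_const_mul, h]
  · congr 1
    have hpow := Real.rpow_add hs 1 (-(-b + 1))
    rw [Real.rpow_one] at hpow
    rw [div_one, div_one, div_one, mul_one, ← mul_assoc, ← hpow]
    congr 2 <;> ring
  · filter_upwards [self_mem_ae_restrict measurableSet_Ioi] with t ht
    have ht : 0 < t := ht
    positivity

/-- The integral of `s / (s + ‖x‖ ^ α)` over the plane. Writing the integrand as a Laplace integral
and exchanging the integrals yields `Γ (2 / α) * Γ (1 - 2 / α)`, and the reflection formula
applies. -/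
lemma lintegral_div_add_norm_rpow {α s : ℝ} (hα : 2 < α) (hs : 0 < s) :
    ∫⁻ x : Plane, ENNReal.ofReal (s / (s + ‖x‖ ^ α)) =
      ENNReal.ofReal (2 * Real.pi ^ 2 * s ^ (2 / α) / (α * Real.sin (2 * Real.pi / α))) := by
  have hα0 : 0 < α := by linarith
  have hb : 2 / α < 1 := (div_lt_one hα0).2 hα
  have hK : 0 ≤ 2 * Real.pi * (1 / α * Real.Gamma (2 / α)) := by
    have := Real.Gamma_pos_of_pos (s := 2 / α) (by positivity)
    positivity
  have h1 : ∀ x : Plane, ENNReal.ofReal (s / (s + ‖x‖ ^ α)) =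
      ∫⁻ t in Set.Ioi (0 : ℝ), ENNReal.ofReal (s * Real.exp (-s * t)) *
        ENNReal.ofReal (Real.exp (-t * ‖x‖ ^ α)) := by
    intro x
    have hx : 0 < s + ‖x‖ ^ α := by positivity
    have h := lintegral_Ioi_exp_neg_mul hx 0
    rw [mul_zero, Real.exp_zero] at h
    rw [div_eq_mul_one_div, ENNReal.ofReal_mul hs.le, ← h, ← lintegral_const_mul _ (by fun_prop)]
    refine lintegral_congr fun t => ?_
    rw [← ENNReal.ofReal_mul hs.le, ← ENNReal.ofReal_mul (by positivity), mul_assoc,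
      ← Real.exp_add]
    congr 3
    ring
  simp_rw [h1]
  rw [lintegral_lintegral_swap (by fun_prop)]
  calc ∫⁻ t in Set.Ioi (0 : ℝ), ∫⁻ x : Plane, ENNReal.ofReal (s * Real.exp (-s * t)) *
        ENNReal.ofReal (Real.exp (-t * ‖x‖ ^ α))
      = ∫⁻ t in Set.Ioi (0 : ℝ), ENNReal.ofReal (2 * Real.pi * (1 / α * Real.Gamma (2 / α))) *
          ENNReal.ofReal (s * (t ^ (-(2 / α)) * Real.exp (-s * t))) := by
        refine setLIntegral_congr_fun measurableSet_Ioi fun t ht => ?_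
        have ht : 0 < t := ht
        rw [lintegral_const_mul _ (by fun_prop), lintegral_exp_neg_mul_norm_rpow hα0 ht,
          ← ENNReal.ofReal_mul (by positivity), ← ENNReal.ofReal_mul hK]
        congr 1
        ring
    _ = ENNReal.ofReal (2 * Real.pi * (1 / α * Real.Gamma (2 / α))) *
          ENNReal.ofReal (s ^ (2 / α) * Real.Gamma (1 - 2 / α)) := by
        rw [lintegral_const_mul _ (by fun_prop), lintegral_exp_neg_mul_rpow hs hb]
    _ = _ := by
        rw [← ENNReal.ofReal_mul hK]
        congr 1
        have h := Real.Gamma_mul_Gamma_one_sub (2 / α)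
        rw [show Real.pi * (2 / α) = 2 * Real.pi / α by ring] at h
        calc 2 * Real.pi * (1 / α * Real.Gamma (2 / α)) * (s ^ (2 / α) * Real.Gamma (1 - 2 / α))
            = 2 * Real.pi * (1 / α) * s ^ (2 / α) *
                (Real.Gamma (2 / α) * Real.Gamma (1 - 2 / α)) := by ring
          _ = _ := by
            rw [h, ← div_div]
            ring

/-- The exponent of the Laplace transform of the interference, per unit density. -/
lemma lintegral_one_sub_expNeg_log {α s : ℝ} (hα : 2 < α) (hs : 0 ≤ s) (y : Plane) :
    ∫⁻ x : Plane, (1 - expNeg (ENNReal.ofReal (Real.log (1 + s * dist x y ^ (-α))))) =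
      ENNReal.ofReal (2 * Real.pi ^ 2 * s ^ (2 / α) / (α * Real.sin (2 * Real.pi / α))) := by
  have hα0 : 0 < α := by linarith
  rcases hs.eq_or_lt with rfl | hs
  · simp [Real.zero_rpow (div_pos two_pos hα0).ne']
  rw [← lintegral_div_add_norm_rpow hα hs,
    ← lintegral_sub_right_eq_self (fun x : Plane => ENNReal.ofReal (s / (s + ‖x‖ ^ α))) y]
  refine lintegral_congr_ae ?_
  -- The single point `y` is left out: there `0 ^ (-α) = 0` in `ℝ`, so the integrands differ.
  filter_upwards [(volume : Measure Plane).ae_ne y] with x hx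
  have hρ : 0 < ‖x - y‖ := norm_pos_iff.2 (sub_ne_zero.2 hx)
  have ha : 0 < s * dist x y ^ (-α) := by rw [dist_eq_norm]; positivity
  rw [expNeg_ofReal (Real.log_nonneg (by linarith)), Real.exp_neg, Real.exp_log (by linarith),
    ← ENNReal.ofReal_one, ← ENNReal.ofReal_sub _ (by positivity), dist_eq_norm,
    Real.rpow_neg hρ.le]
  congr 1
  have hρα : 0 < ‖x - y‖ ^ α := by positivity
  field_simp
  ring

/-! ### Coverage -/

lemma uavPower_nonneg {Pu η : ℝ} (hPu : 0 ≤ Pu) (hη : 0 ≤ η) (αu h r : ℝ) (l : Bool) :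
    0 ≤ uavPower Pu αu η h r l := by
  have : 0 ≤ uavDist h r ^ (-αu) := Real.rpow_nonneg (Real.sqrt_nonneg _) _
  cases l <;> simp only [uavPower] <;> positivity

lemma losProb_nonneg {C : ℝ} (hC : 0 ≤ C) (B h r : ℝ) : 0 ≤ losProb B C h r := by
  unfold losProb
  positivity

lemma losProb_le_one {C : ℝ} (hC : 0 ≤ C) (B h r : ℝ) : losProb B C h r ≤ 1 := by
  have : 0 ≤ C * Real.exp (-B * (elevation h r - C)) := by positivity
  exact div_le_one_of_le₀ (by linarith) (by linarith)

/-- Normalization of the coverage event by the mean received signal power. Positivity of the gain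
`g₀` makes the quotient in `sinr` harmless when its denominator is `0` or `∞`. -/
lemma ofReal_le_sinr_iff {ι : Type*} {Pd α d₀ N β U g₀ : ℝ} (hPd : 0 < Pd) (hd₀ : 0 < d₀)
    (hN : 0 ≤ N) (hβ : 0 ≤ β) (hU : 0 ≤ U) (hg₀ : 0 < g₀) (y : Plane) (x : ι → Plane)
    (g : ι → ℝ) :
    ENNReal.ofReal β ≤ sinr (d2dPower Pd α d₀ g₀) (d2dInterference Pd α y x g) U N ↔
      ENNReal.ofReal (β * d₀ ^ α * (U + N) / Pd) +
        ∑' i, ENNReal.ofReal (β * d₀ ^ α * dist (x i) y ^ (-α) * g i) ≤ ENNReal.ofReal g₀ := by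
  have hd : 0 < d₀ ^ α := Real.rpow_pos_of_pos hd₀ α
  have hd' : 0 < d₀ ^ (-α) := Real.rpow_pos_of_pos hd₀ (-α)
  have hS : 0 < d2dPower Pd α d₀ g₀ := by unfold d2dPower; positivity
  have hk : 0 < d₀ ^ α / Pd := by positivity
  rw [sinr, ENNReal.le_div_iff_mul_le (.inr (ENNReal.ofReal_pos.2 hS).ne')
    (.inr ENNReal.ofReal_ne_top), ← ENNReal.mul_le_mul_iff_right (ENNReal.ofReal_pos.2 hk).ne'
    ENNReal.ofReal_ne_top]
  have hL : ENNReal.ofReal (d₀ ^ α / Pd) * (ENNReal.ofReal β *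
      (d2dInterference Pd α y x g + ENNReal.ofReal U + ENNReal.ofReal N)) =
      ENNReal.ofReal (β * d₀ ^ α * (U + N) / Pd) +
        ∑' i, ENNReal.ofReal (β * d₀ ^ α * dist (x i) y ^ (-α) * g i) := by
    rw [← mul_assoc, ← ENNReal.ofReal_mul hk.le, add_assoc, ← ENNReal.ofReal_add hU hN, mul_add,
      add_comm, ← ENNReal.ofReal_mul (by positivity), d2dInterference, ← ENNReal.tsum_mul_left]
    congr 1
    · congr 1
      ring
    · refine tsum_congr fun i => ?_
      rw [← ENNReal.ofReal_mul (by positivity), d2dPower]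
      congr 1
      field_simp
  have hR : ENNReal.ofReal (d₀ ^ α / Pd) * ENNReal.ofReal (d2dPower Pd α d₀ g₀) =
      ENNReal.ofReal g₀ := by
    rw [← ENNReal.ofReal_mul hk.le, d2dPower, Real.rpow_neg hd₀.le]
    congr 1
    field_simp
  rw [hL, hR]

section Network

variable {Ω ι : Type*} [MeasurableSpace Ω] {μ : Measure Ω}

lemma ae_pos_of_hasLaw_expMeasure {g : Ω → ℝ} (hg : Measurable g)
    (hlaw : HasLaw g (expMeasure 1) μ) : ∀ᵐ ω ∂μ, 0 < g ω := by
  have h0 : expMeasure 1 (Set.Iic 0) = 0 := by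
    rw [← lintegral_indicator_one measurableSet_Iic,
      lintegral_expMeasure_one (measurable_one.indicator measurableSet_Iic)]
    refine (setLIntegral_congr_fun measurableSet_Ioi fun x hx => ?_).trans lintegral_zero
    have hx : ¬ x ≤ 0 := not_le.2 hx
    simp [hx]
  rw [← hlaw.map_eq, Measure.map_apply hg measurableSet_Iic] at h0
  rw [ae_iff]
  convert h0 using 2
  ext ω
  simp

/-- Averaging over positions and gains, with the power of the UAV fixed: `v` is the normalized
deterministic interference and `s` the normalized mean power at unit distance. -/
lemma IsNetwork.measure_add_tsum_le [Countable ι] [IsProbabilityMeasure μ]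
    {X : ι → Ω → Plane} {g : Option ι → Ω → ℝ} {L : Ω → Bool} {lam p : ℝ}
    (hnet : IsNetwork μ X g L lam p) {α s : ℝ} (hα : 2 < α) (hs : 0 ≤ s) (y : Plane)
    (v : ℝ≥0∞) :
    μ {ω | v + ∑' i, ENNReal.ofReal (s * dist (X i ω) y ^ (-α) * g (some i) ω) ≤
        ENNReal.ofReal (g none ω)} =
      expNeg v * expNeg (ENNReal.ofReal lam * ENNReal.ofReal
        (2 * Real.pi ^ 2 * s ^ (2 / α) / (α * Real.sin (2 * Real.pi / α)))) := by
  let a : Plane → ℝ := fun x => s * dist x y ^ (-α)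
  have ha : Measurable a := by fun_prop
  have ha0 : ∀ x, 0 ≤ a x := fun x => mul_nonneg hs (Real.rpow_nonneg dist_nonneg _)
  have hX : Measurable fun ω i => X i ω := measurable_pi_lambda _ hnet.measurable_location
  have hg : Measurable fun ω k => g k ω := measurable_pi_lambda _ hnet.measurable_gain
  let S : Set ((ι → Plane) × (Option ι → ℝ)) :=
    {q | v + ∑' i, ENNReal.ofReal (a (q.1 i) * q.2 (some i)) ≤ ENNReal.ofReal (q.2 none)}
  have hS : MeasurableSet S := by
    refine measurableSet_le (Measurable.const_add (Measurable.tsum fun i => ?_) v) (by fun_prop)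
    fun_prop
  let f : Plane → ℝ≥0∞ := fun x => ENNReal.ofReal (Real.log (1 + a x))
  have hf : Measurable f := by fun_prop
  have hF : Measurable fun x : ι → Plane => expNeg (∑' i, f (x i)) :=
    measurable_expNeg.comp (Measurable.tsum fun i => hf.comp (measurable_pi_apply i))
  have hsection : ∀ x : ι → Plane, μ.map (fun ω k => g k ω) (Prod.mk x ⁻¹' S) =
      expNeg v * expNeg (∑' i, f (x i)) := by
    intro x
    rw [Measure.map_apply hg (measurable_prodMk_left hS)]
    exact measure_add_tsum_gain_le hnet.measurable_gain hnet.rayleigh hnet.indep_gain v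
      fun i => ha0 (x i)
  have : IsProbabilityMeasure (μ.map fun ω k => g k ω) :=
    Measure.isProbabilityMeasure_map hg.aemeasurable
  have : SigmaFinite (ENNReal.ofReal lam • (volume : Measure Plane)) :=
    inferInstanceAs (SigmaFinite (lam.toNNReal • (volume : Measure Plane)))
  calc _ = μ.map (fun ω => ((fun i => X i ω), (fun k => g k ω))) S := by
        rw [Measure.map_apply (hX.prodMk hg) hS]
        rfl
    _ = ∫⁻ ω, expNeg v * expNeg (∑' i, f (X i ω)) ∂μ := by
        rw [(indepFun_iff_map_prod_eq_prod_map_map hX.aemeasurable hg.aemeasurable).1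
          hnet.indep_location_gain, Measure.prod_apply hS]
        simp_rw [hsection]
        rw [lintegral_map (hF.const_mul _) hX]
    _ = expNeg v * ∫⁻ ω, expNeg (∫⁻ x, f x ∂(pointMeasure fun i => X i ω)) ∂μ := by
        refine (lintegral_const_mul _ (hF.comp hX)).trans ?_
        simp_rw [pointMeasure, lintegral_sum_measure, lintegral_dirac' _ hf]
        rfl
    _ = _ := by
        rw [hnet.poisson.lintegral_expNeg_lintegral hf, lintegral_smul_measure, smul_eq_mul,
          lintegral_one_sub_expNeg_log hα hs y]

lemma IsNetwork.measure_los [IsProbabilityMeasure μ] {X : ι → Ω → Plane}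
    {g : Option ι → Ω → ℝ} {L : Ω → Bool} {lam p : ℝ} (hnet : IsNetwork μ X g L lam p)
    (l : Bool) : μ (L ⁻¹' {l}) = ENNReal.ofReal (if l then p else 1 - p) := by
  have ht : μ.real (L ⁻¹' {true}) = p := hnet.prob_los
  rw [← ofReal_measureReal]
  congr 1
  cases l
  · have hc : L ⁻¹' {false} = (L ⁻¹' {true})ᶜ := by
      ext ω
      simp
    rw [hc, probReal_compl_eq_one_sub (hnet.measurable_los (measurableSet_singleton _)), ht]
    rfl
  · exact ht

/-- The probability of coverage together with a given type `l` of the connection to the UAV. -/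
lemma IsNetwork.measure_coverage_inter_los [Countable ι] [IsProbabilityMeasure μ]
    {X : ι → Ω → Plane} {g : Option ι → Ω → ℝ} {L : Ω → Bool} {lam p : ℝ}
    (hnet : IsNetwork μ X g L lam p) {Pd Pu αd αu η d₀ N h r φ β : ℝ}
    (hPd : 0 < Pd) (hPu : 0 ≤ Pu) (hαd : 2 < αd) (hη : 0 ≤ η)
    (hd₀ : 0 < d₀) (hN : 0 ≤ N) (hβ : 0 ≤ β) (l : Bool) :
    μ ({ω | ENNReal.ofReal β ≤ d2dSinr Pd Pu αd αu η d₀ N h r φ X g L ω} ∩ L ⁻¹' {l}) =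
      expNeg (ENNReal.ofReal (β * d₀ ^ αd * (uavPower Pu αu η h r l + N) / Pd)) *
        expNeg (ENNReal.ofReal lam * ENNReal.ofReal
          (2 * Real.pi ^ 2 * (β * d₀ ^ αd) ^ (2 / αd) /
            (αd * Real.sin (2 * Real.pi / αd)))) *
        ENNReal.ofReal (if l then p else 1 - p) := by
  have hs : 0 ≤ β * d₀ ^ αd := mul_nonneg hβ (Real.rpow_nonneg hd₀.le _)
  let y := polarPoint r φ
  let v := ENNReal.ofReal (β * d₀ ^ αd * (uavPower Pu αu η h r l + N) / Pd)
  let S : Set ((ι → Plane) × (Option ι → ℝ)) :=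
    {q | v + ∑' i, ENNReal.ofReal (β * d₀ ^ αd * dist (q.1 i) y ^ (-αd) * q.2 (some i)) ≤
      ENNReal.ofReal (q.2 none)}
  have hS : MeasurableSet S := by
    refine measurableSet_le (Measurable.const_add (Measurable.tsum fun i => ?_) v) (by fun_prop)
    fun_prop
  rw [← hnet.measure_los l, ← hnet.measure_add_tsum_le hαd hs y v]
  have hind := hnet.indep_los.measure_inter_preimage_eq_mul S {l} hS (measurableSet_singleton l)
  refine Eq.trans (measure_congr ?_) hind
  filter_upwards [ae_pos_of_hasLaw_expMeasure (hnet.measurable_gain none) (hnet.rayleigh none)]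
    with ω hω
  refine propext (and_congr_left fun hl => ?_)
  have hl : L ω = l := hl
  refine Iff.trans ?_ (ofReal_le_sinr_iff hPd hd₀ hN hβ (uavPower_nonneg hPu hη αu h r l) hω y
    (fun i => X i ω) fun i => g (some i) ω)
  rw [← hl]
  rfl

end Network

end UAVD2D

theorem theorem1 {Ω ι : Type*} [MeasurableSpace Ω] [Countable ι]
    (μ : Measure Ω) [IsProbabilityMeasure μ]
    (X : ι → Ω → UAVD2D.Plane) (g : Option ι → Ω → ℝ) (L : Ω → Bool)
    (lam Pd Pu αd αu η d₀ N h r φ B C β : ℝ)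
    (hlam : 0 ≤ lam) (hPd : 0 < Pd) (hPu : 0 ≤ Pu) (hαd : 2 < αd) (hη : 0 ≤ η)
    (hd₀ : 0 < d₀) (hN : 0 ≤ N) (hh : 0 < h) (hr : 0 ≤ r) (hC : 0 ≤ C) (hβ : 0 ≤ β)
    (hnet : UAVD2D.IsNetwork μ X g L lam (UAVD2D.losProb B C h r)) :
    μ.real {ω | ENNReal.ofReal β ≤ UAVD2D.d2dSinr Pd Pu αd αu η d₀ N h r φ X g L ω} =
      Real.exp (-(2 * Real.pi ^ 2 * lam * β ^ (2 / αd) * d₀ ^ 2) /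
            (αd * Real.sin (2 * Real.pi / αd)) - β * d₀ ^ αd * N / Pd) *
        (UAVD2D.losProb B C h r *
            Real.exp (-(β * d₀ ^ αd * Pu * Real.sqrt (h ^ 2 + r ^ 2) ^ (-αu)) / Pd) +
          UAVD2D.nlosProb B C h r *
            Real.exp (-(β * d₀ ^ αd * η * Pu * Real.sqrt (h ^ 2 + r ^ 2) ^ (-αu)) / Pd)) := by
  set p := UAVD2D.losProb B C h r with hp
  have hα0 : 0 < αd := by linarith
  have hd : 0 < d₀ ^ αd := Real.rpow_pos_of_pos hd₀ _
  have hs : 0 ≤ β * d₀ ^ αd := by positivity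
  have hpow : (β * d₀ ^ αd) ^ (2 / αd) = β ^ (2 / αd) * d₀ ^ 2 := by
    rw [Real.mul_rpow hβ hd.le, ← Real.rpow_mul hd₀.le, mul_div_cancel₀ _ hα0.ne', Real.rpow_two]
  have hsin : 0 < Real.sin (2 * Real.pi / αd) := by
    refine Real.sin_pos_of_pos_of_lt_pi (by positivity) ?_
    rw [div_lt_iff₀ hα0, mul_comm]
    exact mul_lt_mul_of_pos_left hαd Real.pi_pos
  have hJ : 0 ≤ 2 * Real.pi ^ 2 * (β * d₀ ^ αd) ^ (2 / αd) /
      (αd * Real.sin (2 * Real.pi / αd)) := by positivity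
  have hU := UAVD2D.uavPower_nonneg hPu hη αu h r
  have hq : ∀ l : Bool, 0 ≤ if l then p else 1 - p := by
    intro l
    cases l
    · simpa using UAVD2D.losProb_le_one hC B h r
    · simpa using UAVD2D.losProb_nonneg hC B h r
  have key : ∀ l : Bool,
      μ.real ({ω | ENNReal.ofReal β ≤ UAVD2D.d2dSinr Pd Pu αd αu η d₀ N h r φ X g L ω} ∩
        L ⁻¹' {l}) =
      Real.exp (-(2 * Real.pi ^ 2 * lam * β ^ (2 / αd) * d₀ ^ 2) /
            (αd * Real.sin (2 * Real.pi / αd)) - β * d₀ ^ αd * N / Pd) *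
        ((if l then p else 1 - p) *
          Real.exp (-(β * d₀ ^ αd * UAVD2D.uavPower Pu αu η h r l) / Pd)) := by
    intro l
    have hv : 0 ≤ β * d₀ ^ αd * (UAVD2D.uavPower Pu αu η h r l + N) / Pd := by
      have := hU l
      positivity
    rw [Measure.real, hnet.measure_coverage_inter_los hPd hPu hαd hη hd₀ hN hβ l,
      ← ENNReal.ofReal_mul hlam, UAVD2D.expNeg_ofReal hv,
      UAVD2D.expNeg_ofReal (mul_nonneg hlam hJ), ENNReal.toReal_mul, ENNReal.toReal_mul,
      ENNReal.toReal_ofReal (Real.exp_pos _).le, ENNReal.toReal_ofReal (Real.exp_pos _).le,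
      ENNReal.toReal_ofReal (hq l), ← Real.exp_add, mul_comm _ (ite _ _ _),
      mul_left_comm (Real.exp _), ← Real.exp_add, hpow]
    congr 2
    ring
  have hcompl : (L ⁻¹' {true})ᶜ = L ⁻¹' {false} := by
    ext ω
    simp
  rw [← measureReal_inter_add_sdiff (μ := μ)
      (s := {ω | ENNReal.ofReal β ≤ UAVD2D.d2dSinr Pd Pu αd αu η d₀ N h r φ X g L ω})
      (hnet.measurable_los (measurableSet_singleton true)),
    Set.sdiff_eq_compl_inter, Set.inter_comm (L ⁻¹' {true})ᶜ, hcompl, key, key, ← mul_add]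
  simp only [if_true, UAVD2D.uavPower, UAVD2D.uavDist, UAVD2D.nlosProb, Bool.false_eq_true,
    if_false, mul_assoc, ← hp]
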